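/- Let $K>0$ be a real number. A \emph{proper shift rule} is a finite signed Borel measure $\phi$ on $\mathbb R$. Let $\mathcal F_K$ be the space of all bounded, continuously differentiable functions $f\colon\mathbb R\to\mathbb R$ whose Fourier spectrum, i.e. the support of the Fourier transform $\hat f$ of $f$ as a tempered distribution (normalized by $\hat u(\xi)=\int e^{-2\pi i\xi x}u(x)\,dx$ for Schwartz functions $u$), is contained in $[-K,K]$. A proper shift rule $\phi$ is called \emph{feasible} for $\mathcal F_K$ if $$f'(x)=\int_{\mathbb R} f(x-s)\,d\phi(s)\qquad\text{for all } f\in\mathcal F_K \text{ and all } x\in\mathbb R .$$ Then the series $$\phi_K \;:=\; 2K\sum_{a\in\frac12+\mathbb Z}\frac{(-1)^{a+\frac12}}{\pi a^2}\,\delta_{a/(2K)},$$ where $\delta_y$ denotes the Dirac measure at $y$, converges (unconditionally) in the total-variation norm to a finite signed Borel measure $\phi_K$ on $\mathbb R$ (the Nyquist shift rule), and $\phi_K$ is a feasible proper shift rule for $\mathcal F_K$. In particular, for $K=\frac12$, $\phi_{1/2}=\sum_{a\in\frac12+\mathbb Z}\frac{(-1)^{a+1/2}}{\pi a^2}\,\delta_a$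 is feasible for $\mathcal F_{1/2}$. -/

import Mathlib

open MeasureTheory Filter Topology
open scoped SchwartzMap FourierTransform ENNReal

noncomputable section

/-! ### Bounded band-limited functions -/

/-- A bounded continuous real function, viewed as complex valued, is essentially bounded. -/
theorem memLp_top_ofReal {f : ℝ → ℝ} (hc : Continuous f) (hb : ∃ C, ∀ x, |f x| ≤ C) :
    MemLp (fun x : ℝ => (f x : ℂ)) ∞ (volume : Measure ℝ) := by
  obtain ⟨C, hC⟩ := hb
  refine memLp_top_of_bound (Complex.continuous_ofReal.comp hc).aestronglyMeasurable C ?_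
  exact Eventually.of_forall fun x => by simpa using hC x

/-- The tempered distribution `u ↦ ∫ u(x) f(x) dx` of a bounded continuous real function. -/
def boundedTempered (f : ℝ → ℝ) (hc : Continuous f) (hb : ∃ C, ∀ x, |f x| ≤ C) : 𝓢'(ℝ, ℂ) :=
  Lp.toTemperedDistribution (memLp_top_ofReal hc hb).toLp

/-- The defining formula of the tempered distribution of a bounded continuous function. -/
theorem boundedTempered_apply (f : ℝ → ℝ) (hc : Continuous f) (hb : ∃ C, ∀ x, |f x| ≤ C)
    (u : 𝓢(ℝ, ℂ)) : boundedTempered f hc hb u = ∫ x, u x * (f x : ℂ) := by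
  rw [boundedTempered, Lp.toTemperedDistribution_apply]
  refine integral_congr_ae ?_
  filter_upwards [(memLp_top_ofReal hc hb).coeFn_toLp] with x hx
  rw [hx, smul_eq_mul]

/-- The Fourier spectrum of a bounded continuous real function: the support of the Fourier
transform of the tempered distribution that it defines. -/
def fourierSpectrum (f : ℝ → ℝ) (hc : Continuous f) (hb : ∃ C, ∀ x, |f x| ≤ C) : Set ℝ :=
  Distribution.dsupport (𝓕 (boundedTempered f hc hb) : 𝓢'(ℝ, ℂ))

/-- The space `F_K` of bounded continuously differentiable functions `f : ℝ → ℝ` with Fourier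
spectrum contained in `[-K, K]`. -/
def bandlimitedSpace (K : ℝ) : Set (ℝ → ℝ) :=
  {f | ∃ (hf : ContDiff ℝ 1 f) (hb : ∃ C, ∀ x, |f x| ≤ C),
    fourierSpectrum f hf.continuous hb ⊆ Set.Icc (-K) K}

/-! ### Proper shift rules: finite signed Borel measures on the real line -/

/-- A proper shift rule `φ` (a finite signed Borel measure) is feasible for a space `G` of bounded
continuously differentiable functions if `f' (x) = ∫ f (x - s) dφ(s)` for all `f ∈ G` and all `x`;
the integral is required to exist. -/
def IsFeasible (φ : SignedMeasure ℝ) (G : Set (ℝ → ℝ)) : Prop :=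
  ∀ f ∈ G, ∀ x : ℝ, φ.Integrable (fun s => f (x - s)) ∧
    deriv f x = ∫ᵛ s, f (x - s) ∂•φ

/-- The series `∑ n, μ n` of signed measures converges (unconditionally) to `φ` in the
total-variation norm. -/
def HasTVSum {ι : Type*} (μ : ι → SignedMeasure ℝ) (φ : SignedMeasure ℝ) : Prop :=
  Tendsto (fun s : Finset ι => (φ - ∑ n ∈ s, μ n).totalVariation Set.univ) atTop (𝓝 0)

/-- For a summable `c`, the signed measure `∑ n, c n • δ (p n)`, given setwise. -/
def diracSeries (c p : ℤ → ℝ) (hc : Summable c) : SignedMeasure ℝ where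
  measureOf' E := ∑' n, (c n • VectorMeasure.dirac (p n) (1 : ℝ)) E
  empty' := by simp
  not_measurable' E hE := by simp [hE]
  m_iUnion' E hE hd := by
    have hsum (s : Finset ℕ) :
        ∑ i ∈ s, ∑' n, (c n • VectorMeasure.dirac (p n) (1 : ℝ)) (E i)
          = ∑' n, ∑ i ∈ s, (c n • VectorMeasure.dirac (p n) (1 : ℝ)) (E i) := by
      refine (Summable.tsum_finsetSum fun i _ => ?_).symm
      refine hc.norm.of_norm_bounded fun n => ?_
      by_cases h : p n ∈ E i <;> simp [h, hE i]
    have hbound (s : Finset ℕ) (n : ℤ) :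
        ‖∑ i ∈ s, (c n • VectorMeasure.dirac (p n) (1 : ℝ)) (E i)‖ ≤ ‖c n‖ := by
      rw [← VectorMeasure.of_biUnion_finset (fun i _ j _ hij => hd hij) fun i _ => hE i]
      by_cases h : p n ∈ ⋃ i ∈ s, E i
      · simp [h, Finset.measurableSet_biUnion s fun i _ => hE i]
      · simp [h]
    simp only [HasSum, hsum]
    exact tendsto_tsum_of_dominated_convergence hc.norm
      (fun n => VectorMeasure.m_iUnion _ hE hd)
      (Eventually.of_forall fun s n => hbound s n)

/-! ### The Nyquist shift rule

The index `a ∈ 1/2 + ℤ` is written `a = 1/2 + n` with `n : ℤ`, so that `a + 1/2 = n + 1`. -/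

/-- The weight `2K (-1)^(a + 1/2) / (π a²)` of the Nyquist shift rule, `a = 1/2 + n`. -/
def nyquistWeight (K : ℝ) (n : ℤ) : ℝ :=
  2 * K * ((-1) ^ (n + 1) / (Real.pi * (1 / 2 + (n : ℝ)) ^ 2))

/-- The shift `a / (2K)` of the Nyquist shift rule, `a = 1/2 + n`. -/
def nyquistShift (K : ℝ) (n : ℤ) : ℝ :=
  (1 / 2 + (n : ℝ)) / (2 * K)

theorem summable_nyquistWeight (K : ℝ) : Summable (nyquistWeight K) := by
  refine Summable.mul_left _ ?_
  have h := ((Real.summable_one_div_int_add_rpow (1 / 2) 2).2 (by norm_num)).mul_left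
    (Real.pi)⁻¹
  refine h.of_norm_bounded fun n => le_of_eq ?_
  rw [norm_div, norm_zpow, norm_neg, norm_one, one_zpow, Real.norm_eq_abs, abs_mul,
    abs_of_pos Real.pi_pos, abs_of_nonneg (sq_nonneg _), Real.rpow_two, sq_abs, add_comm]
  simp [mul_comm]

/-- The Nyquist shift rule `φ_K = 2K ∑_{a ∈ 1/2 + ℤ} (-1)^(a + 1/2) / (π a²) δ_{a/(2K)}`. -/
def nyquistShiftRule (K : ℝ) : SignedMeasure ℝ :=
  diracSeries (nyquistWeight K) (nyquistShift K) (summable_nyquistWeight K)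

end

/-! The measure-theoretic part is a tail estimate: the remainder of a series of weighted Dirac
measures has variation at most the remainder of the series of absolute values of the weights
(`variation_diracSeries_sub_sum_le`). It gives the convergence in total variation, and shows that
the integral of a bounded continuous function is the corresponding weighted series of its values
(`hasSum_integral_diracSeries`). Feasibility thus means that `f' (x) = ∑ w n * f (x - s n)`, with
the Nyquist weights `w n` and shifts `s n`.

On the Fourier side this formula says that the triangle wave `∑ w n * e^{-2πi ξ s n}` equals
`2πiξ` on `[-K, K]` (`hasSum_nyquistWeight_mul_exp`), which follows from the Fourier series of the
second Bernoulli polynomial by removing the even frequencies. For a continuous integrable function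
whose Fourier transform vanishes outside `[-K, K]`, integrating that series termwise against the
Fourier transform proves the formula (`hasSum_nyquistWeight_mul_of_fourier_eq_zero`).

A bounded `C¹` function `f` with spectrum in `[-K, K]` need not be integrable, and its Fourier
transform, a distribution, cannot be multiplied by the triangle wave, which has kinks at `±K`. So
`f` is multiplied by `x ↦ 𝓕 ψ (ε x)`, where `ψ` is a test function supported in `[-1, 1]`. The
product is integrable and its Fourier transform vanishes outside `[-(K + ε), K + ε]`
(`fourier_mul_fourier_dilate_eq_zero`), so the formula holds for it with parameter `K + ε`. As
`ε → 0`, both sides converge to those of the formula for `f`, times the nonzero constant `𝓕 ψ 0`.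
-/

/-! ### Series of Dirac measures -/

theorem diracSeries_apply (c p : ℤ → ℝ) (hc : Summable c) (E : Set ℝ) :
    diracSeries c p hc E = ∑' n, (c n • VectorMeasure.dirac (p n) (1 : ℝ)) E := rfl

theorem norm_smul_dirac_apply_le (c p : ℝ) (E : Set ℝ) :
    ‖(c • VectorMeasure.dirac p (1 : ℝ)) E‖ ≤ ‖c‖ := by
  by_cases hE : MeasurableSet E
  · by_cases h : p ∈ E <;> simp [h, hE]
  · simp [hE]

/-- The tails of the series `∑ n, c n • δ (p n)` are dominated in variation by the tails of
`∑ n, |c n|`. -/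
theorem variation_diracSeries_sub_sum_le (c p : ℤ → ℝ) (hc : Summable c) (s : Finset ℤ) :
    (diracSeries c p hc - ∑ n ∈ s, c n • VectorMeasure.dirac (p n) (1 : ℝ)).variation Set.univ ≤
      ∑' n : {n // n ∉ s}, ‖c n‖ₑ := by
  let m : Measure ℝ := Measure.sum fun n : {n // n ∉ s} => ‖c n‖ₑ • Measure.dirac (p n)
  have hm (E : Set ℝ) (hE : MeasurableSet E) :
      m E = ∑' n : {n // n ∉ s}, ‖(c n • VectorMeasure.dirac (p n) (1 : ℝ)) E‖ₑ := by
    rw [Measure.sum_apply _ hE]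
    refine tsum_congr fun n => ?_
    by_cases h : p n ∈ E <;> simp [h, hE]
  have hle : (diracSeries c p hc -
      ∑ n ∈ s, c n • VectorMeasure.dirac (p n) (1 : ℝ)).variation ≤ m := by
    refine VectorMeasure.variation_le_of_forall_enorm_le fun E hE => ?_
    have hs : Summable fun n => (c n • VectorMeasure.dirac (p n) (1 : ℝ)) E :=
      hc.norm.of_norm_bounded fun n => norm_smul_dirac_apply_le _ _ _
    have : (diracSeries c p hc - ∑ n ∈ s, c n • VectorMeasure.dirac (p n) (1 : ℝ)) E
        = ∑' n : {n // n ∉ s}, (c n • VectorMeasure.dirac (p n) (1 : ℝ)) E := by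
      rw [sub_apply, diracSeries_apply, FunLike.coe_sum, Finset.sum_apply,
        ← hs.sum_add_tsum_subtype_compl s, add_sub_cancel_left]
    rw [this, hm E hE]
    exact enorm_tsum_le_tsum_enorm
  refine (hle _).trans_eq ?_
  rw [hm _ MeasurableSet.univ]
  simp

theorem tendsto_variation_diracSeries_sub_sum (c p : ℤ → ℝ) (hc : Summable c) :
    Tendsto (fun s : Finset ℤ => (diracSeries c p hc -
      ∑ n ∈ s, c n • VectorMeasure.dirac (p n) (1 : ℝ)).variation Set.univ) atTop (𝓝 0) := by
  have hfin : ∑' n, ‖c n‖ₑ ≠ ∞ := by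
    have := hc.norm.tsum_ofReal_ne_top
    simpa only [ofReal_norm] using this
  exact tendsto_of_tendsto_of_tendsto_of_le_of_le tendsto_const_nhds
    (ENNReal.tendsto_tsum_compl_atTop_zero hfin) (fun _ => zero_le)
    (variation_diracSeries_sub_sum_le c p hc)

theorem hasTVSum_diracSeries (c p : ℤ → ℝ) (hc : Summable c) :
    HasTVSum (fun n => c n • VectorMeasure.dirac (p n) (1 : ℝ)) (diracSeries c p hc) := by
  simpa only [HasTVSum, SignedMeasure.totalVariation_eq_variation] using
    tendsto_variation_diracSeries_sub_sum c p hc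

/-- A bounded continuous function is integrable against every finite signed measure. -/
theorem SignedMeasure.integrable_of_continuous_of_bounded (φ : SignedMeasure ℝ) {g : ℝ → ℝ}
    (hg : Continuous g) {C : ℝ} (hC : ∀ x, |g x| ≤ C) : φ.Integrable g := by
  have : IsFiniteMeasure φ.variation := by
    rw [← SignedMeasure.totalVariation_eq_variation]; infer_instance
  exact Integrable.of_bound hg.aestronglyMeasurable C (ae_of_all _ hC)

/-- The integral of a bounded continuous function against `∑ n, c n • δ (p n)` is the sum of the
series `∑ n, c n * g (p n)`. -/
theorem hasSum_integral_diracSeries (c p : ℤ → ℝ) (hc : Summable c) {g : ℝ → ℝ}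
    (hg : Continuous g) {C : ℝ} (hC : ∀ x, |g x| ≤ C) :
    HasSum (fun n => c n * g (p n)) (∫ᵛ x, g x ∂•(diracSeries c p hc)) := by
  have hint (φ : SignedMeasure ℝ) : φ.Integrable g :=
    SignedMeasure.integrable_of_continuous_of_bounded φ hg hC
  have hdiff (s : Finset ℤ) : (∫ᵛ x, g x ∂•(diracSeries c p hc)) - ∑ n ∈ s, c n * g (p n)
      = ∫ᵛ x, g x ∂•(diracSeries c p hc -
        ∑ n ∈ s, c n • VectorMeasure.dirac (p n) (1 : ℝ)) := by
    rw [VectorMeasure.integral_sub_vectorMeasure (hint _) (hint _),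
      VectorMeasure.integral_finsetSum_vectorMeasure fun _ _ => hint _]
    congr 1
    refine Finset.sum_congr rfl fun n _ => ?_
    rw [VectorMeasure.integral_smul_vectorMeasure, VectorMeasure.integral_dirac]
    simp
  rw [HasSum, tendsto_iff_edist_tendsto_0]
  have hlim := ENNReal.Tendsto.const_mul (a := ENNReal.ofReal C *
      ‖(ContinuousLinearMap.lsmul ℝ ℝ : ℝ →L[ℝ] ℝ →L[ℝ] ℝ)‖ₑ)
    (tendsto_variation_diracSeries_sub_sum c p hc) (Or.inr (by finiteness))
  rw [mul_zero] at hlim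
  refine tendsto_of_tendsto_of_tendsto_of_le_of_le tendsto_const_nhds hlim
    (fun _ => zero_le) fun s => ?_
  rw [edist_comm, edist_eq_enorm_sub, hdiff]
  refine VectorMeasure.enorm_integral_le_of_enorm_le_const (ae_of_all _ fun x => ?_)
  rw [← ofReal_norm]
  exact ENNReal.ofReal_le_ofReal (hC x)

/-! ### The Fourier series of the triangle wave -/

/-- `∑_{m ≠ 0} e^{2πimy} / m² = 2π² (y² - y + 1/6)` on `[0, 1]`. The sum is written over all of
`ℤ`, since the term `m = 0` is `1 / 0 = 0`. -/
theorem hasSum_one_div_sq_mul_exp {y : ℝ} (hy : y ∈ Set.Icc (0 : ℝ) 1) :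
    HasSum (fun m : ℤ => 1 / (m : ℂ) ^ 2 * Complex.exp (2 * Real.pi * Complex.I * m * y))
      ((2 * Real.pi ^ 2 * (y ^ 2 - y + 1 / 6) : ℝ) : ℂ) := by
  have h := hasSum_one_div_pow_mul_fourier_mul_bernoulliFun (le_refl 2) hy
  have hB : bernoulliFun 2 y = y ^ 2 - y + 1 / 6 := by
    simp [bernoulliFun, Polynomial.bernoulli, Finset.sum_range_succ, bernoulli,
      bernoulli'_two, bernoulli'_one, bernoulli'_zero]
    ring
  have hval : -(2 * Real.pi * Complex.I) ^ 2 / (Nat.factorial 2 : ℂ) * (bernoulliFun 2 y : ℂ)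
      = ((2 * Real.pi ^ 2 * (y ^ 2 - y + 1 / 6) : ℝ) : ℂ) := by
    rw [hB, mul_pow, Complex.I_sq, Nat.factorial_two]
    push_cast
    ring
  rw [hval] at h
  simpa [fourier_coe_apply] using h

/-- Removing the even frequencies leaves the sum over odd ones, which is linear on `[0, 1/2]`. -/
theorem hasSum_one_div_odd_sq_mul_exp {y : ℝ} (hy : y ∈ Set.Icc (0 : ℝ) (1 / 2)) :
    HasSum (fun n : ℤ => 1 / (2 * n + 1 : ℂ) ^ 2 *
        Complex.exp (2 * Real.pi * Complex.I * (2 * n + 1) * y))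
      ((Real.pi ^ 2 * (1 / 4 - y) : ℝ) : ℂ) := by
  have h1 := hasSum_one_div_sq_mul_exp (y := y) ⟨hy.1, by linarith [hy.2]⟩
  have h2 := (hasSum_one_div_sq_mul_exp (y := 2 * y)
    ⟨by linarith [hy.1], by linarith [hy.2]⟩).mul_left (1 / 4)
  set F : ℤ → ℂ := fun m => 1 / (m : ℂ) ^ 2 * Complex.exp (2 * Real.pi * Complex.I * m * y) with hF
  have hEinj : Function.Injective fun n : ℤ => 2 * n := fun a b h => by simpa using h
  have hOinj : Function.Injective fun n : ℤ => 2 * n + 1 := fun a b h => by simpa using h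
  have he : HasSum (F ∘ fun n : ℤ => 2 * n)
      (1 / 4 * ((2 * Real.pi ^ 2 * ((2 * y) ^ 2 - 2 * y + 1 / 6) : ℝ) : ℂ)) := by
    have hcomp : (F ∘ fun n : ℤ => 2 * n) = fun n : ℤ => 1 / 4 * (1 / (n : ℂ) ^ 2 *
        Complex.exp (2 * Real.pi * Complex.I * n * ((2 * y : ℝ) : ℂ))) := by
      ext n
      simp only [hF, Function.comp]
      push_cast
      rw [show (2 * Real.pi * Complex.I * n * (2 * y) : ℂ)
        = 2 * Real.pi * Complex.I * (2 * n) * y by ring, mul_pow]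
      simp only [one_div, mul_inv]
      ring
    rw [hcomp]
    exact h2
  have ho : Summable (F ∘ fun n : ℤ => 2 * n + 1) := h1.summable.comp_injective hOinj
  have hcompl : IsCompl (Set.range fun n : ℤ => 2 * n) (Set.range fun n : ℤ => 2 * n + 1) := by
    rw [show (Set.range fun n : ℤ => 2 * n) = {n | Even n} by
        ext n; simp [even_iff_exists_two_mul],
      show (Set.range fun n : ℤ => 2 * n + 1) = {n | ¬ Even n} by
        ext n; simp [Odd]]
    exact isCompl_compl
  have hsum := HasSum.add_isCompl (f := F) hcompl ((hEinj.hasSum_range_iff).2 he)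
    ((hOinj.hasSum_range_iff).2 ho.hasSum)
  have := h1.unique hsum
  have hval : ∑' n, (F ∘ fun n : ℤ => 2 * n + 1) n = ((Real.pi ^ 2 * (1 / 4 - y) : ℝ) : ℂ) := by
    push_cast at this ⊢
    linear_combination -this
  rw [← hval]
  simpa [hF, Function.comp_def] using ho.hasSum

/-- The Fourier series of the triangle wave: the Fourier transform of the Nyquist shift rule of
parameter `K` agrees with `2πiξ` on `[-K, K]`. -/
theorem hasSum_nyquistWeight_mul_exp {K : ℝ} (hK : 0 < K) {ξ : ℝ} (hξ : |ξ| ≤ K) :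
    HasSum (fun n : ℤ => (nyquistWeight K n : ℂ) *
        Complex.exp (-(2 * Real.pi * Complex.I * ξ * nyquistShift K n)))
      (2 * Real.pi * Complex.I * ξ) := by
  obtain ⟨h1, h2⟩ := abs_le.1 hξ
  have ht1 : ξ / K ≤ 1 := (div_le_one hK).2 h2
  have ht2 : -1 ≤ ξ / K := by rw [le_div_iff₀ hK]; linarith
  have ht : ξ / (4 * K) = ξ / K / 4 := by field_simp
  have h := (hasSum_one_div_odd_sq_mul_exp (y := 1 / 4 - ξ / (4 * K))
    ⟨by rw [ht]; linarith, by rw [ht]; linarith⟩).mul_left (8 * K * Complex.I / Real.pi)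
  have hK' : (K : ℂ) ≠ 0 := by exact_mod_cast hK.ne'
  have hpi : (Real.pi : ℂ) ≠ 0 := by exact_mod_cast Real.pi_ne_zero
  have hval : 8 * K * Complex.I / Real.pi *
      ((Real.pi ^ 2 * (1 / 4 - (1 / 4 - ξ / (4 * K))) : ℝ) : ℂ)
      = 2 * Real.pi * Complex.I * ξ := by
    push_cast
    field_simp
    ring
  rw [hval] at h
  refine h.congr_fun fun n => ?_
  have hn : (2 * n + 1 : ℂ) ≠ 0 := by
    have : (2 * n + 1 : ℤ) ≠ 0 := by omega
    exact_mod_cast this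
  -- the signs are absorbed into a translation by `1/4`: `e^{2πi (2n + 1) / 4} = (-1) ^ n i`
  have hexp : Complex.exp (2 * Real.pi * Complex.I * (2 * n + 1) *
        ((1 / 4 - ξ / (4 * K) : ℝ) : ℂ))
      = (-1) ^ n * Complex.I *
        Complex.exp (-(2 * Real.pi * Complex.I * ξ * nyquistShift K n)) := by
    rw [← Complex.exp_pi_mul_I, ← Complex.exp_int_mul]
    nth_rewrite 3 [← Complex.exp_pi_div_two_mul_I]
    rw [← Complex.exp_add, ← Complex.exp_add]
    congr 1
    simp only [nyquistShift]
    push_cast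
    field_simp
    ring
  rw [hexp]
  simp only [nyquistWeight]
  push_cast
  rw [zpow_add_one₀ (by norm_num), show (1 / 2 + n : ℂ) = (2 * n + 1) / 2 by ring]
  field_simp
  linear_combination (-(8 : ℂ)) * Complex.I_sq

/-! ### Distributional support -/

open scoped Manifold ContDiff in
/-- A tempered distribution annihilates every compactly supported test function whose support
avoids the distributional support: a smooth partition of unity on the support of the test function
cuts it into finitely many pieces, each supported where the distribution vanishes. -/
theorem TemperedDistribution.apply_eq_zero_of_disjoint_dsupport {E F : Type*}
    [NormedAddCommGroup E] [NormedSpace ℝ E] [FiniteDimensional ℝ E] [NormedAddCommGroup F]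
    [NormedSpace ℂ F] (T : 𝓢'(E, F)) (u : 𝓢(E, ℂ)) (hu : HasCompactSupport u)
    (hd : Disjoint (tsupport u) (Distribution.dsupport T)) : T u = 0 := by
  have hloc (x : tsupport u) : ∃ a, Distribution.IsVanishingOn T a ∧ IsOpen a ∧ (x : E) ∈ a :=
    (Distribution.notMem_dsupport_iff _).1 (Set.disjoint_left.1 hd x.2)
  choose U hU hUo hxU using hloc
  obtain ⟨t, ht⟩ := hu.isCompact.elim_finite_subcover U hUo
    fun x hx => Set.mem_iUnion_of_mem ⟨x, hx⟩ (hxU ⟨x, hx⟩)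
  obtain ⟨f, hf⟩ := SmoothPartitionOfUnity.exists_isSubordinate 𝓘(ℝ, E) (isClosed_tsupport u)
    (fun i : t => U i) (fun i => hUo i) (by rwa [Set.iUnion_subtype])
  have hsmooth (i : t) : ContDiff ℝ ∞ fun x => (f i x : ℂ) * u x :=
    (Complex.ofRealCLM.contDiff.comp (f i).contMDiff.contDiff).mul u.smooth'
  let v (i : t) : 𝓢(E, ℂ) := (hu.mul_left (f := fun x => (f i x : ℂ))).toSchwartzMap (hsmooth i)
  have huv : u = ∑ i, v i := by
    ext x
    rw [sum_apply]
    change u x = ∑ i, (f i x : ℂ) * u x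
    by_cases hx : x ∈ tsupport u
    · have h1 := f.sum_eq_one hx
      rw [finsum_eq_sum_of_fintype] at h1
      rw [← Finset.sum_mul, ← Complex.ofReal_sum, h1, Complex.ofReal_one, one_mul]
    · simp [image_eq_zero_of_notMem_tsupport hx]
  rw [huv, map_sum]
  refine Finset.sum_eq_zero fun i _ => hU i (v i) (Set.Subset.trans ?_ (hf i))
  refine closure_mono fun x hx => ?_
  contrapose! hx
  have : f i x = 0 := by simpa using hx
  change ¬ ((f i x : ℂ) * u x ≠ 0)
  simp [this]

/-! ### Integrable band-limited functions -/

/-- If `g` is continuous and integrable and its Fourier transform vanishes outside `[-K, K]`, then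
the Nyquist series of `g` is its derivative: on the Fourier side this is the triangle wave series,
integrated term by term. -/
theorem hasSum_nyquistWeight_mul_of_fourier_eq_zero {K : ℝ} (hK : 0 < K) {g : ℝ → ℂ}
    (hg : Continuous g) (hint : Integrable g) (hsupp : ∀ ξ, K < |ξ| → 𝓕 g ξ = 0) (x : ℝ) :
    HasSum (fun n : ℤ => (nyquistWeight K n : ℂ) * g (x - nyquistShift K n)) (deriv g x) := by
  have hcont : Continuous (𝓕 g) := VectorFourier.fourierIntegral_continuous Real.continuous_fourierChar
    (by exact continuous_inner) hint
  have hcs : HasCompactSupport (𝓕 g) := by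
    refine HasCompactSupport.intro (isCompact_Icc (a := -K) (b := K)) fun ξ hξ => hsupp ξ ?_
    by_contra! h
    exact hξ (abs_le.1 h)
  have hgint : Integrable (𝓕 g) := hcont.integrable_of_hasCompactSupport hcs
  have hinv (y : ℝ) : g y = 𝓕 (𝓕 g) (-y) := by
    rw [← Real.fourierInv_eq_fourier_neg, hg.fourierInv_fourier_eq hint hgint]
  have hmulint : Integrable fun ξ : ℝ => ξ • 𝓕 g ξ :=
    (continuous_id.smul hcont).integrable_of_hasCompactSupport hcs.smul_left
  have hderiv : deriv g x = ∫ ξ : ℝ, Complex.exp (2 * Real.pi * Complex.I * ξ * x) *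
      (2 * Real.pi * Complex.I * ξ * 𝓕 g ξ) := by
    have h := (Real.hasDerivAt_fourier hgint hmulint (-x)).scomp x (hasDerivAt_neg x)
    have hg' : g = 𝓕 (𝓕 g) ∘ fun y => -y := funext hinv
    rw [← hg'] at h
    rw [h.deriv, Real.fourier_real_eq_integral_exp_smul, ← integral_smul]
    refine integral_congr_ae (ae_of_all _ fun ξ => ?_)
    simp only [smul_eq_mul, Complex.real_smul]
    push_cast
    rw [show (-2 * Real.pi * ξ * -x * Complex.I : ℂ) = 2 * Real.pi * Complex.I * ξ * x by ring]
    ring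
  have hterm (n : ℤ) : (nyquistWeight K n : ℂ) * g (x - nyquistShift K n) =
      ∫ ξ : ℝ, nyquistWeight K n * (Complex.exp (2 * Real.pi * Complex.I * ξ * x) *
        Complex.exp (-(2 * Real.pi * Complex.I * ξ * nyquistShift K n)) * 𝓕 g ξ) := by
    rw [hinv, Real.fourier_real_eq_integral_exp_smul, integral_const_mul]
    congr 1
    refine integral_congr_ae (ae_of_all _ fun ξ => ?_)
    simp only [smul_eq_mul]
    rw [← Complex.exp_add]
    push_cast
    congr 2
    ring
  have hnorm (a b : ℝ) : ‖Complex.exp (2 * Real.pi * Complex.I * a * b)‖ = 1 := by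
    rw [show (2 * Real.pi * Complex.I * a * b : ℂ) = (2 * Real.pi * a * b : ℝ) * Complex.I by
      push_cast; ring, Complex.norm_exp_ofReal_mul_I]
  simp_rw [hterm, hderiv]
  refine hasSum_integral_of_dominated_convergence
    (fun n ξ => |nyquistWeight K n| * ‖𝓕 g ξ‖) (fun n => ?_) (fun n => ae_of_all _ fun ξ => ?_)
    (ae_of_all _ fun ξ => (summable_nyquistWeight K).abs.mul_right _) ?_
    (ae_of_all _ fun ξ => ?_)
  · exact Continuous.aestronglyMeasurable (by fun_prop)
  · rw [norm_mul, norm_mul, norm_mul, hnorm, Complex.exp_neg, norm_inv, hnorm]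
    simp
  · simp_rw [tsum_mul_right]
    exact hgint.norm.const_mul _
  · by_cases hξ : |ξ| ≤ K
    · have h := ((hasSum_nyquistWeight_mul_exp hK hξ).mul_right (𝓕 g ξ)).mul_left
        (Complex.exp (2 * Real.pi * Complex.I * ξ * x))
      exact h.congr_fun fun n => by ring
    · simp [hsupp ξ (not_le.1 hξ)]

/-! ### Bounded band-limited functions: regularization and limit -/

/-- There is a test function supported in `[-1, 1]` whose Fourier transform does not vanish at the
origin. -/
theorem exists_schwartzMap_tsupport_subset_fourier_zero_ne_zero :
    ∃ ψ : 𝓢(ℝ, ℂ), tsupport ψ ⊆ Set.Icc (-1) 1 ∧ 𝓕 ψ 0 ≠ 0 := by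
  let b : ContDiffBump (0 : ℝ) := ⟨1 / 2, 1, by norm_num, by norm_num⟩
  have hcs : HasCompactSupport (Complex.ofRealCLM ∘ b) := b.hasCompactSupport.comp_left rfl
  refine ⟨hcs.toSchwartzMap (Complex.ofRealCLM.contDiff.comp b.contDiff), ?_, ?_⟩
  · change tsupport (Complex.ofRealCLM ∘ b) ⊆ _
    refine (tsupport_comp_subset rfl _).trans ?_
    rw [b.tsupport_eq, Real.closedBall_eq_Icc]
    simp [b]
  · have h : 𝓕 (hcs.toSchwartzMap (Complex.ofRealCLM.contDiff.comp b.contDiff)) 0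
        = ((∫ t, b t : ℝ) : ℂ) := by
      rw [SchwartzMap.fourier_coe, Real.fourier_real_eq_integral_exp_smul, ← integral_complex_ofReal]
      simp
    rw [h]
    exact_mod_cast (b.integral_pos (μ := volume)).ne'

/-- The Fourier transform of the test function `t ↦ ψ ((t - ξ) / ε)`. -/
theorem fourier_comp_sub_div (ψ : ℝ → ℂ) {ε : ℝ} (hε : 0 < ε) (ξ x : ℝ) :
    𝓕 (fun t => ψ ((t - ξ) / ε)) x =
      ε * (Complex.exp ((-2 * Real.pi * x * ξ : ℝ) * Complex.I) * 𝓕 ψ (ε * x)) := by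
  simp only [Real.fourier_real_eq_integral_exp_smul, smul_eq_mul]
  let G : ℝ → ℂ := fun t => Complex.exp ((-2 * Real.pi * (ε * t + ξ) * x : ℝ) * Complex.I) * ψ t
  have h (v : ℝ) : Complex.exp ((-2 * Real.pi * v * x : ℝ) * Complex.I) * ψ ((v - ξ) / ε)
      = G ((v - ξ) / ε) := by
    simp only [G]
    rw [mul_div_cancel₀ _ hε.ne', sub_add_cancel]
  simp_rw [h]
  rw [integral_sub_right_eq_self (fun v => G (v / ε)) ξ, Measure.integral_comp_div, abs_of_pos hε,
    Complex.real_smul, ← integral_const_mul (Complex.exp _)]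
  congr 1
  refine integral_congr_ae (ae_of_all _ fun t => ?_)
  simp only [G]
  rw [← mul_assoc, ← Complex.exp_add]
  congr 2
  push_cast
  ring

/-- Multiplying a bounded function with spectrum in `[-K, K]` by the dilate `x ↦ 𝓕 ψ (ε x)`, where
`ψ` is supported in `[-1, 1]`, gives a function whose Fourier transform vanishes outside
`[-(K + ε), K + ε]`: its value at `ξ` is the distributional Fourier transform of `f`, tested
against a function supported in `[ξ - ε, ξ + ε]`. -/
theorem fourier_mul_fourier_dilate_eq_zero {K : ℝ} {f : ℝ → ℝ} (hc : Continuous f)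
    (hb : ∃ C, ∀ x, |f x| ≤ C) (hsp : fourierSpectrum f hc hb ⊆ Set.Icc (-K) K)
    (ψ : 𝓢(ℝ, ℂ)) (hψ : tsupport ψ ⊆ Set.Icc (-1) 1) {ε : ℝ} (hε : 0 < ε) {ξ : ℝ}
    (hξ : K + ε < |ξ|) : 𝓕 (fun x => (f x : ℂ) * 𝓕 ψ (ε * x)) ξ = 0 := by
  have hsupp (t : ℝ) (ht : t ∉ Set.Icc (ξ - ε) (ξ + ε)) : ψ ((t - ξ) / ε) = 0 := by
    refine image_eq_zero_of_notMem_tsupport fun h => ht ?_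
    obtain ⟨h1, h2⟩ := hψ h
    rw [le_div_iff₀ hε] at h1
    rw [div_le_iff₀ hε] at h2
    constructor <;> linarith
  have hcs : HasCompactSupport fun t => ψ ((t - ξ) / ε) := .intro isCompact_Icc hsupp
  let u : 𝓢(ℝ, ℂ) := hcs.toSchwartzMap (ψ.smooth'.comp (by fun_prop))
  have hu : tsupport u ⊆ Set.Icc (ξ - ε) (ξ + ε) :=
    closure_minimal (fun t ht => by_contra fun h => ht (hsupp t h)) isClosed_Icc
  have hzero := TemperedDistribution.apply_eq_zero_of_disjoint_dsupport
    (𝓕 (boundedTempered f hc hb)) u hcs (Set.disjoint_left.2 fun t ht htd => by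
      obtain ⟨h1, h2⟩ := hu ht
      obtain ⟨h3, h4⟩ := hsp htd
      exact absurd (abs_le.2 ⟨by linarith, by linarith⟩) (not_le.2 hξ))
  rw [TemperedDistribution.fourier_apply, boundedTempered_apply] at hzero
  have hint : ∫ x, 𝓕 u x * (f x : ℂ)
      = ε * 𝓕 (fun x => (f x : ℂ) * 𝓕 ψ (ε * x)) ξ := by
    rw [Real.fourier_real_eq_integral_exp_smul, ← integral_const_mul]
    refine integral_congr_ae (ae_of_all _ fun x => ?_)
    have : 𝓕 u x = _ := (congrFun (SchwartzMap.fourier_coe u) x).trans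
      (fourier_comp_sub_div ψ hε ξ x)
    simp only [this, smul_eq_mul, SchwartzMap.fourier_coe]
    ring
  rw [hint] at hzero
  exact (mul_eq_zero.1 hzero).resolve_left (by exact_mod_cast hε.ne')

/-- The Nyquist series of a bounded `C¹` function with spectrum in `[-K, K]` is its derivative. The
formula holds, at parameter `K + ε`, for the product of `f` with a slowly varying band-limited
Schwartz function; the limit `ε → 0` is a dominated one. -/
theorem hasSum_nyquistWeight_mul_of_mem_bandlimitedSpace {K : ℝ} (hK : 0 < K) {f : ℝ → ℝ}
    (hf : f ∈ bandlimitedSpace K) (x : ℝ) :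
    HasSum (fun n : ℤ => nyquistWeight K n * f (x - nyquistShift K n)) (deriv f x) := by
  obtain ⟨hf1, hb, hsp⟩ := hf
  have hc := hf1.continuous
  obtain ⟨C, hC⟩ := hb
  obtain ⟨ψ, hψ, hψ0⟩ := exists_schwartzMap_tsupport_subset_fourier_zero_ne_zero
  set e : 𝓢(ℝ, ℂ) := 𝓕 ψ with he
  obtain ⟨M, hM⟩ : ∃ M, ∀ y, ‖e y‖ ≤ M := by
    obtain ⟨M, -, hM⟩ := e.decay 0 0
    exact ⟨M, fun y => by simpa using hM y⟩
  have hfd : Differentiable ℝ f := hf1.differentiable (by norm_num)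
  have happrox {ε : ℝ} (hε : 0 < ε) :
      HasSum (fun n : ℤ => (nyquistWeight (K + ε) n : ℂ) * ((f (x - nyquistShift (K + ε) n) : ℂ) *
          e (ε * (x - nyquistShift (K + ε) n))))
        (((deriv f x : ℝ) : ℂ) * e (ε * x) + f x * (ε * deriv e (ε * x))) := by
    have hdil : Integrable fun y => e (ε * y) := e.integrable.comp_mul_left' hε.ne'
    have h := hasSum_nyquistWeight_mul_of_fourier_eq_zero (K := K + ε) (by positivity)
      (g := fun y => (f y : ℂ) * e (ε * y)) (by fun_prop)
      (hdil.bdd_mul (Complex.continuous_ofReal.comp hc).aestronglyMeasurable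
        (ae_of_all _ fun y => by simpa using hC y))
      (fun ξ hξ => fourier_mul_fourier_dilate_eq_zero hc ⟨C, hC⟩ hsp ψ hψ hε hξ) x
    have hd := (hfd x).hasDerivAt.ofReal_comp.mul
      ((e.differentiable (ε * x)).hasDerivAt.scomp x ((hasDerivAt_id x).const_mul ε))
    have hd' : deriv (fun y => (f y : ℂ) * e (ε * y)) x
        = ((deriv f x : ℝ) : ℂ) * e (ε * x) + f x * (ε * deriv e (ε * x)) := by
      refine hd.deriv.trans ?_
      simp
    rwa [hd'] at h
  have hid : Tendsto (fun ε : ℝ => ε) (𝓝[>] 0) (𝓝 0) := nhdsWithin_le_nhds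
  have hKε : Tendsto (fun ε : ℝ => K + ε) (𝓝[>] 0) (𝓝 K) := by
    simpa using hid.const_add K
  have hshift (n : ℤ) : Tendsto (fun ε : ℝ => nyquistShift (K + ε) n) (𝓝[>] 0)
      (𝓝 (nyquistShift K n)) :=
    tendsto_const_nhds.div (hKε.const_mul 2) (by positivity)
  have hweight (n : ℤ) : Tendsto (fun ε : ℝ => nyquistWeight (K + ε) n) (𝓝[>] 0)
      (𝓝 (nyquistWeight K n)) := (hKε.const_mul 2).mul_const _
  -- for `ε < 1` the weights at `K + ε` are bounded by those at `K + 1`, which are summable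
  have hlim : Tendsto (fun ε : ℝ => ∑' n : ℤ, (nyquistWeight (K + ε) n : ℂ) *
        ((f (x - nyquistShift (K + ε) n) : ℂ) * e (ε * (x - nyquistShift (K + ε) n))))
      (𝓝[>] 0) (𝓝 (∑' n : ℤ, (nyquistWeight K n : ℂ) *
        ((f (x - nyquistShift K n) : ℂ) * e 0))) := by
    refine tendsto_tsum_of_dominated_convergence
      (bound := fun n => |nyquistWeight (K + 1) n| * (C * M))
      ((summable_nyquistWeight (K + 1)).abs.mul_right _) (fun n => ?_) ?_
    · have h1 : Tendsto (fun ε : ℝ => x - nyquistShift (K + ε) n) (𝓝[>] 0)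
          (𝓝 (x - nyquistShift K n)) := (hshift n).const_sub x
      have h2 := hid.mul h1
      rw [zero_mul] at h2
      exact ((Complex.continuous_ofReal.tendsto _).comp (hweight n)).mul
        (((Complex.continuous_ofReal.tendsto _).comp ((hc.tendsto _).comp h1)).mul
          ((e.continuous.tendsto _).comp h2))
    · filter_upwards [Ioo_mem_nhdsGT (zero_lt_one' ℝ)] with ε hε n
      have hw : |nyquistWeight (K + ε) n| ≤ |nyquistWeight (K + 1) n| := by
        simp only [nyquistWeight, abs_mul _ (_ / _)]
        refine mul_le_mul_of_nonneg_right ?_ (abs_nonneg _)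
        rw [abs_of_pos (by linarith [hε.1]), abs_of_pos (by linarith)]
        linarith [hε.2]
      rw [norm_mul, norm_mul, Complex.norm_real, Complex.norm_real, Real.norm_eq_abs,
        Real.norm_eq_abs]
      exact mul_le_mul hw (mul_le_mul (hC _) (hM _) (norm_nonneg _)
        ((abs_nonneg _).trans (hC 0))) (by positivity) (abs_nonneg _)
  have hlim' : Tendsto (fun ε : ℝ =>
        ((deriv f x : ℝ) : ℂ) * e (ε * x) + f x * (ε * deriv e (ε * x)))
      (𝓝[>] 0) (𝓝 (((deriv f x : ℝ) : ℂ) * e 0)) := by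
    have hcd : Continuous (deriv e) := (e.smooth 1).continuous_deriv (by norm_num)
    have : Continuous fun ε : ℝ =>
        ((deriv f x : ℝ) : ℂ) * e (ε * x) + f x * (ε * deriv e (ε * x)) := by fun_prop
    simpa using (this.tendsto 0).mono_left nhdsWithin_le_nhds
  have heq : ((deriv f x : ℝ) : ℂ) * e 0 =
      ∑' n : ℤ, (nyquistWeight K n : ℂ) * ((f (x - nyquistShift K n) : ℂ) * e 0) :=
    tendsto_nhds_unique (hlim'.congr' (by
      filter_upwards [self_mem_nhdsWithin] with ε hε using (happrox hε).tsum_eq.symm)) hlim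
  simp_rw [← mul_assoc, tsum_mul_right] at heq
  have hval : deriv f x = ∑' n : ℤ, nyquistWeight K n * f (x - nyquistShift K n) := by
    have := mul_right_cancel₀ hψ0 heq
    exact_mod_cast this
  rw [hval]
  refine Summable.hasSum (((summable_nyquistWeight K).abs.mul_right C).of_norm_bounded fun n => ?_)
  rw [norm_mul, Real.norm_eq_abs, Real.norm_eq_abs]
  exact mul_le_mul_of_nonneg_left (hC _) (abs_nonneg _)

theorem mainTheorem1 (K : ℝ) (hK : 0 < K) :
    HasTVSum (fun n : ℤ => nyquistWeight K n •
        VectorMeasure.dirac (nyquistShift K n) (1 : ℝ)) (nyquistShiftRule K) ∧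
      IsFeasible (nyquistShiftRule K) (bandlimitedSpace K) := by
  refine ⟨hasTVSum_diracSeries _ _ (summable_nyquistWeight K), fun f hf x => ?_⟩
  obtain ⟨hf1, ⟨C, hC⟩, -⟩ := id hf
  have hcont : Continuous fun s => f (x - s) := hf1.continuous.comp (by fun_prop)
  exact ⟨SignedMeasure.integrable_of_continuous_of_bounded _ hcont fun s => hC (x - s),
    (hasSum_nyquistWeight_mul_of_mem_bandlimitedSpace hK hf x).unique
      (hasSum_integral_diracSeries _ _ (summable_nyquistWeight K) hcont fun s => hC (x - s))⟩
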